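/- Let $G$ be a finitely generated group. Let $\operatorname{Sym}(G\oplus\mathbb Z)$ be the group of all permutations of the underlying set of the direct product $G\oplus\mathbb Z$, and regard $G\le G\oplus\mathbb Z$ as subgroups of $\operatorname{Sym}(G\oplus\mathbb Z)$ via the left regular action of $G\oplus\mathbb Z$ on itself. Then there is a finitely generated group $H$ with $G\le G\oplus\mathbb Z\le H\le\operatorname{Sym}(G\oplus\mathbb Z)$ such that: (1) there is a short exact sequence $1\to N\to H\to G\oplus\mathbb Z\to 1$ in which $N$ is locally finite, i.e. every finitely generated subgroup of $N$ is finite; (2) the natural action of $H$ on $G\oplus\mathbb Z$, which extends the left regular action of $G\oplus\mathbb Z$, is highly transitive: it is faithful, and for all $k\in\mathbb N$ and all $k$-tuples $(x_1,\dots,x_k)$ and $(y_1,\dots,y_k)$ of pairwise distinct elements of $G\oplus\mathbb Z$ there is $h\in H$ with $h\cdot x_i=y_i$ for $1\le i\le k$; (3) $H$ is mixed identity free: for every non-trivial element $W$ of the free product $H*\mathbb Z$ there is a homomorphism $H*\mathbb Z\to H$ which restricts to the identity on $H$ and does not map $W$ to the identity. -/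

import Mathlib

/-- A group is locally finite if each of its finitely generated subgroups is finite. -/
def LocallyFiniteGroup (N : Type*) [Group N] : Prop :=
  ∀ K : Subgroup N, K.FG → Finite K

/-- An action is `k`-transitive if the set has at least `k` points and any `k` distinct points
can be moved, in order, to any other `k` distinct points by one element of the group. -/
def IsKTransitive (H Ω : Type*) [Group H] [MulAction H Ω] (k : ℕ) : Prop :=
  (k : ℕ∞) ≤ ENat.card Ω ∧ MulAction.IsMultiplyPretransitive H Ω k

/-- An action is highly transitive if it is faithful and `k`-transitive for every `k`. -/
def IsHighlyTransitive (H Ω : Type*) [Group H] [MulAction H Ω] : Prop :=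
  FaithfulSMul H Ω ∧ ∀ k : ℕ, IsKTransitive H Ω k

/-- `W ∈ H ∗ ℤ` is a non-trivial mixed identity of `H` if `W ≠ 1` and every homomorphism
`H ∗ ℤ → H` that restricts to the identity on `H` maps `W` to `1`. -/
def IsNontrivialMixedIdentity (H : Type*) [Group H]
    (W : Monoid.Coprod H (Multiplicative ℤ)) : Prop :=
  W ≠ 1 ∧ ∀ φ : Monoid.Coprod H (Multiplicative ℤ) →* H,
    φ.comp Monoid.Coprod.inl = MonoidHom.id H → φ W = 1

/-- A group is mixed identity free if it has no non-trivial mixed identity. -/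
def MixedIdentityFree (H : Type*) [Group H] : Prop :=
  ¬ ∃ W : Monoid.Coprod H (Multiplicative ℤ), IsNontrivialMixedIdentity H W

/-- The left regular representation `A → Sym(A)`, `a ↦ (x ↦ a * x)`. -/
def leftRegular (A : Type*) [Group A] : A →* Equiv.Perm A :=
  MulAction.toPermHom A A

/-! Write A = G × ℤ. The group H is generated by the translations of A and one permutation τ
(`limitPerm f`), the limit of finitely supported τₖ. Here τₖ₊₁ consists of τₖ, a copy of τₖ shifted
far up the ℤ-axis, and between them an isolated transposition (c, c · f k), where f takes each value
infinitely often.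

Translating the isolated transpositions moves any p to any q while fixing a given finite set
(`movesRelFinite_mainGroup`), whence high transitivity. The shifted copies make every element of H
commute at each point with infinitely many central shifts, so non-trivial elements have infinite
support (`infinite_setOf_smul_ne`). With these two facts a reduced word can be evaluated along a
finite partial injection so that it moves a point, and some element of H extends that injection:
there are no mixed identities.

Since τ is trivial at negative heights, each element of H is eventually a translation downwards.
This gives H → A, with kernel generated by the translation conjugates of τ. Finitely many of these
preserve finite sets of bounded size covering A, because at large scales the pieces of τₖ₊₁ do not
interact (`HasBoundedInvariantSets.approx_succ`). Such a finitely generated group is finite. -/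

/-! ### A finiteness criterion for permutation groups. -/

section LocallyFinite

/-- A finitely generated group acting faithfully with orbits contained in finite invariant sets of
bounded size is finite. -/
theorem finite_of_bounded_invariant_sets {K Ω : Type*} [Group K] [Group.FG K] [MulAction K Ω]
    [FaithfulSMul K Ω] (n : ℕ)
    (hn : ∀ x : Ω, ∃ C : Finset Ω, x ∈ C ∧ C.card ≤ n ∧ ∀ k : K, ∀ y ∈ C, k • y ∈ C) :
    Finite K := by
  classical
  obtain ⟨S, hS⟩ := Group.fg_def.1 (inferInstance : Group.FG K)
  have hfin : Finite (K →* Equiv.Perm (Fin n)) := by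
    refine Finite.of_injective
      (fun (f : K →* Equiv.Perm (Fin n)) (s : S) => f s) fun f g hfg => ?_
    exact MonoidHom.eq_of_eqOn_dense hS fun s hs => congrFun hfg ⟨s, hs⟩
  -- The joint kernel of all homomorphisms to Sym(n) is trivial: each orbit has at most n points, so
  -- its action is seen in Sym(n).
  refine Finite.of_injective
    (fun (k : K) (f : K →* Equiv.Perm (Fin n)) => f k) fun k l hkl => ?_
  refine FaithfulSMul.eq_of_smul_eq_smul (α := Ω) fun x => ?_
  obtain ⟨C, hxC, hcard, hC⟩ := hn x
  let orb := MulAction.orbit K x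
  have horb : ∀ y ∈ orb, y ∈ C := by
    rintro _ ⟨k, rfl⟩
    exact hC k x hxC
  let ι : orb → Fin n := fun y => Fin.castLE hcard (C.equivFin ⟨y, horb y y.2⟩)
  have hι : Function.Injective ι := by
    intro y z hyz
    have := C.equivFin.injective (Fin.castLE_injective hcard hyz)
    exact Subtype.ext (by simpa using this)
  let f : K →* Equiv.Perm (Fin n) :=
    (Equiv.Perm.viaEmbeddingHom ⟨ι, hι⟩).comp (MulAction.toPermHom K orb)
  have h1 : f k = f l := congrFun hkl f
  have h2 : MulAction.toPermHom K orb k = MulAction.toPermHom K orb l :=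
    Equiv.Perm.viaEmbeddingHom_injective _ h1
  have h3 := congrArg Subtype.val (Equiv.congr_fun h2 ⟨x, MulAction.mem_orbit_self x⟩)
  exact h3

end LocallyFinite

/-! ### Extending finite partial injections. -/

section PartialInjections

/-- A set of pairs is the graph of an injective partial map. -/
def IsPartialInjection {Ω : Type*} (P : Finset (Ω × Ω)) : Prop :=
  ∀ a ∈ P, ∀ b ∈ P, (a.1 = b.1 ↔ a.2 = b.2)

/-- Any point can be moved to any other one by an element fixing a given finite set. -/
def MovesRelFinite (H Ω : Type*) [Group H] [MulAction H Ω] : Prop :=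
  ∀ (Y : Finset Ω) (p q : Ω), p ∉ Y → q ∉ Y → ∃ h : H, (∀ y ∈ Y, h • y = y) ∧ h • p = q

variable {H Ω : Type*} [Group H] [MulAction H Ω]

/-- Pairs are added one at a time: an element realising the earlier pairs is corrected by one that
fixes their targets. -/
theorem MovesRelFinite.exists_extends (hH : MovesRelFinite H Ω) (P : Finset (Ω × Ω))
    (hP : IsPartialInjection P) : ∃ h : H, ∀ a ∈ P, h • a.1 = a.2 := by
  classical
  induction P using Finset.induction_on with
  | empty => exact ⟨1, by simp⟩
  | insert a P ha ih =>
    obtain ⟨h, hh⟩ := ih fun b hb c hc =>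
      hP b (Finset.mem_insert_of_mem hb) c (Finset.mem_insert_of_mem hc)
    have key : ∀ b ∈ P, ¬ (b.1 = a.1) ∧ ¬ (b.2 = a.2) := by
      intro b hb
      have h1 := hP b (Finset.mem_insert_of_mem hb) a (Finset.mem_insert_self a P)
      have h2 : ¬ (b.1 = a.1) := fun h3 => ha (Prod.ext h3 (h1.1 h3) ▸ hb)
      exact ⟨h2, fun h3 => h2 (h1.2 h3)⟩
    obtain ⟨g, hg, hga⟩ := hH (P.image Prod.snd) (h • a.1) a.2
      (by
        intro hmem
        obtain ⟨b, hb, hb2⟩ := Finset.mem_image.1 hmem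
        rw [← hh b hb] at hb2
        exact (key b hb).1 (MulAction.injective h hb2))
      (by
        intro hmem
        obtain ⟨b, hb, hb2⟩ := Finset.mem_image.1 hmem
        exact (key b hb).2 hb2)
    refine ⟨g * h, fun b hb => ?_⟩
    rw [mul_smul]
    rcases Finset.mem_insert.1 hb with rfl | hb
    · exact hga
    · rw [hh b hb]
      exact hg _ (Finset.mem_image_of_mem _ hb)

theorem MovesRelFinite.isHighlyTransitive [FaithfulSMul H Ω] [Infinite Ω]
    (hH : MovesRelFinite H Ω) : IsHighlyTransitive H Ω := by
  classical
  refine ⟨inferInstance, fun k => ⟨by simp [ENat.card_eq_top_of_infinite], ?_⟩⟩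
  rw [MulAction.isMultiplyPretransitive_iff]
  intro x y
  obtain ⟨h, hh⟩ := hH.exists_extends (Finset.univ.image fun i => (x i, y i)) (by
    intro a ha b hb
    obtain ⟨i, -, rfl⟩ := Finset.mem_image.1 ha
    obtain ⟨j, -, rfl⟩ := Finset.mem_image.1 hb
    simp)
  refine ⟨h, ?_⟩
  ext i
  exact hh (x i, y i) (Finset.mem_image_of_mem _ (Finset.mem_univ i))

end PartialInjections

/-! ### Reduced words and mixed identities. -/

section MixedIdentities

open Monoid.Coprod

/-- The value of the word `t^{ε₁} b₁ t^{ε₂} b₂ ⋯`, where `true` and `false` stand for the exponents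
`1` and `-1`. -/
def wordVal {H K : Type*} [Group H] [Group K] (ι : H →* K) (t : K) : List (Bool × H) → K
  | [] => 1
  | a :: L => (cond a.1 t t⁻¹) * (ι a.2 * wordVal ι t L)

/-- A word without cancelling subwords `t t⁻¹` or `t⁻¹ t`. -/
def IsReducedWord {H : Type*} [Group H] (L : List (Bool × H)) : Prop :=
  L.IsChain fun a b => a.2 = 1 → a.1 = b.1

theorem map_wordVal {H K M : Type*} [Group H] [Group K] [Group M] (φ : K →* M) (ι : H →* K)
    (t : K) (L : List (Bool × H)) : φ (wordVal ι t L) = wordVal (φ.comp ι) (φ t) L := by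
  induction L with
  | nil => simp [wordVal]
  | cons a L ih => rcases a with ⟨_ | _, b⟩ <;> simp [wordVal, ih]

variable {H : Type*} [Group H]

/-- A new letter either can be prepended or cancels the first letter of the word. -/
theorem exists_reducedWord_letter_mul {K : Type*} [Group K] (ι : H →* K) (t : K) (ε : Bool)
    (a : H) (L : List (Bool × H)) (hL : IsReducedWord L) :
    ∃ a' L', IsReducedWord L' ∧
      cond ε t t⁻¹ * (ι a * wordVal ι t L) = ι a' * wordVal ι t L' := by
  cases L with
  | nil => exact ⟨1, [(ε, a)], by simp [IsReducedWord], by simp [wordVal]⟩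
  | cons b L =>
    by_cases h : a = 1 → ε = b.1
    · exact ⟨1, (ε, a) :: b :: L, by simpa [IsReducedWord] using ⟨h, hL⟩, by simp [wordVal]⟩
    · push Not at h
      obtain ⟨rfl, h⟩ := h
      refine ⟨b.2, L, hL.tail, ?_⟩
      rcases b with ⟨_ | _, b⟩ <;> rcases ε with _ | _ <;> simp_all [wordVal]

theorem exists_reducedWord (W : Monoid.Coprod H (Multiplicative ℤ)) :
    ∃ a L, IsReducedWord L ∧ W = inl a * wordVal inl (inr (Multiplicative.ofAdd 1)) L := by
  induction W using Monoid.Coprod.induction_on' with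
  | one => exact ⟨1, [], by simp [IsReducedWord], by simp [wordVal]⟩
  | inl_mul m W ih =>
    obtain ⟨a, L, hL, rfl⟩ := ih
    exact ⟨m * a, L, hL, by simp [mul_assoc]⟩
  | inr_mul n W ih =>
    have key : ∀ (ε : Bool) (V : Monoid.Coprod H (Multiplicative ℤ)),
        (∃ a L, IsReducedWord L ∧ V = inl a * wordVal inl (inr (Multiplicative.ofAdd 1)) L) →
        ∃ a L, IsReducedWord L ∧
          cond ε (inr (Multiplicative.ofAdd 1)) (inr (Multiplicative.ofAdd 1))⁻¹ * V =
            inl a * wordVal inl (inr (Multiplicative.ofAdd 1)) L := by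
      rintro ε _ ⟨a, L, hL, rfl⟩
      exact exists_reducedWord_letter_mul (K := Monoid.Coprod H (Multiplicative ℤ)) inl _ ε a L hL
    obtain ⟨n, rfl⟩ := Multiplicative.ofAdd.surjective n
    induction n using Int.induction_on with
    | zero => simpa using ih
    | succ i hi =>
      have := key true _ hi
      rwa [cond_true, ← mul_assoc, ← map_mul, ← ofAdd_add, add_comm] at this
    | pred i hi =>
      have := key false _ hi
      rwa [cond_false, ← mul_assoc, ← map_inv, ← map_mul, ← ofAdd_neg, ← ofAdd_add,
        add_comm, ← sub_eq_add_neg] at this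

variable {Ω : Type*} [MulAction H Ω]

/-- The endpoint at which a partial injection, or its inverse, is defined. -/
def source (ε : Bool) (a : Ω × Ω) : Ω := cond ε a.1 a.2

open Classical in
/-- The set of points occurring in a set of pairs. -/
noncomputable def touched (P : Finset (Ω × Ω)) : Finset Ω := P.image Prod.fst ∪ P.image Prod.snd

theorem source_mem_touched {P : Finset (Ω × Ω)} {a : Ω × Ω} (ha : a ∈ P) (ε : Bool) :
    source ε a ∈ touched P := by
  classical
  cases ε <;> simp only [source, touched, cond, Finset.mem_union, Finset.mem_image]
  · exact Or.inr ⟨a, ha, rfl⟩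
  · exact Or.inl ⟨a, ha, rfl⟩

-- Since q is fresh, a collision could only occur at p, where the letter of sign ε is still
-- undefined.
open Classical in
theorem isPartialInjection_insert {P : Finset (Ω × Ω)} (hP : IsPartialInjection P) (ε : Bool)
    {p q : Ω} (hp : ∀ a ∈ P, source ε a ≠ p) (hq : q ∉ touched P) :
    IsPartialInjection (insert (cond ε (p, q) (q, p)) P) := by
  have hq' : ∀ a ∈ P, ∀ δ, source δ a ≠ q := fun a ha δ h => hq (h ▸ source_mem_touched ha δ)
  have hne : ∀ a ∈ P, a.1 ≠ (cond ε (p, q) (q, p)).1 ∧ a.2 ≠ (cond ε (p, q) (q, p)).2 := by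
    intro a ha
    have h1 := hp a ha
    have h2 := hq' a ha true
    have h3 := hq' a ha false
    cases ε <;> simp_all [source]
  intro a ha b hb
  rcases Finset.mem_insert.1 ha with rfl | ha <;> rcases Finset.mem_insert.1 hb with rfl | hb
  · simp
  · have := hne b hb
    exact ⟨fun h => absurd h.symm this.1, fun h => absurd h.symm this.2⟩
  · have := hne a ha
    exact ⟨fun h => absurd h this.1, fun h => absurd h this.2⟩
  · exact hP a ha b hb

theorem letter_smul_of_extends (h : H) (ε : Bool) {p q : Ω}
    (hh : h • (cond ε (p, q) (q, p)).1 = (cond ε (p, q) (q, p)).2) :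
    cond ε h h⁻¹ • p = q := by
  cases ε
  · simpa using (inv_smul_eq_iff.2 hh.symm)
  · simpa using hh

/-- A reduced word can be evaluated along a finite partial injection up to its first letter, at a
point where that letter is still undefined. -/
theorem exists_partialInjection_of_reducedWord
    (hinf : ∀ h : H, h ≠ 1 → {x : Ω | h • x ≠ x}.Infinite) [Infinite Ω] (p : Ω)
    (ε : Bool) (b : H) (L : List (Bool × H)) (hL : IsReducedWord ((ε, b) :: L)) :
    ∃ (P : Finset (Ω × Ω)) (r : Ω), IsPartialInjection P ∧ (∀ a ∈ P, source ε a ≠ r) ∧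
      ∀ h : H, (∀ a ∈ P, h • a.1 = a.2) → (b * wordVal (MonoidHom.id H) h L) • p = r := by
  classical
  induction L generalizing ε b with
  | nil => exact ⟨∅, b • p, by simp [IsPartialInjection], by simp, by simp [wordVal]⟩
  | cons c L ih =>
    obtain ⟨δ, c⟩ := c
    obtain ⟨P, r, hP, hr, hh⟩ := ih δ c hL.tail
    have hred : b = 1 → ε = δ := by
      have := hL
      simp only [IsReducedWord, List.isChain_cons_cons] at this
      exact this.1
    -- The next letter must be undefined at b • q. For b ≠ 1 infinite support allows b • q to be
    -- fresh too; for b = 1 reducedness gives ε = δ, and q is so far only an endpoint of the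
    -- opposite kind.
    obtain ⟨q, hqP, hqr, hq⟩ : ∃ q, q ∉ touched P ∧ q ≠ r ∧
        (b ≠ 1 → b • q ≠ q ∧ b • q ∉ touched P ∧ b • q ≠ r) := by
      let F : Finset Ω := insert r (touched P)
      by_cases hb : b = 1
      · obtain ⟨q, hq⟩ := Infinite.exists_notMem_finset F
        simp only [F, Finset.mem_insert, not_or] at hq
        exact ⟨q, hq.2, hq.1, fun h => absurd hb h⟩
      · obtain ⟨q, hq1, hq2⟩ :=
          (hinf b hb).exists_notMem_finset (F ∪ F.image fun x => b⁻¹ • x)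
        simp only [Finset.mem_union, not_or, Finset.mem_image, not_exists, not_and] at hq2
        have h3 : b • q ∉ F := fun h => hq2.2 _ h (by simp)
        have h4 := hq2.1
        simp only [F, Finset.mem_insert, not_or] at h3 h4
        exact ⟨q, h4.2, h4.1, fun _ => ⟨hq1, h3.2, h3.1⟩⟩
    refine ⟨insert (cond δ (r, q) (q, r)) P, b • q, isPartialInjection_insert hP δ hr hqP, ?_, ?_⟩
    · intro a ha
      by_cases hb : b = 1
      · obtain rfl := hred hb
        subst hb
        rw [one_smul]
        rcases Finset.mem_insert.1 ha with rfl | ha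
        · cases ε <;> simpa [source] using hqr.symm
        · exact fun h => hqP (h ▸ source_mem_touched ha _)
      · obtain ⟨h1, h2, h3⟩ := hq hb
        rcases Finset.mem_insert.1 ha with rfl | ha
        · cases ε <;> cases δ <;> simp only [source, cond] <;>
            first | exact h1.symm | exact h3.symm
        · exact fun h => h2 (h ▸ source_mem_touched ha _)
    · intro h hext
      have h1 := hh h fun a ha => hext a (Finset.mem_insert_of_mem ha)
      have h2 := letter_smul_of_extends h δ (hext _ (Finset.mem_insert_self _ _))
      simp only [MonoidHom.id_apply, wordVal] at h1 ⊢
      rw [mul_smul, mul_smul, h1, h2]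

theorem MovesRelFinite.mixedIdentityFree [Infinite Ω] (hH : MovesRelFinite H Ω)
    (hinf : ∀ h : H, h ≠ 1 → {x : Ω | h • x ≠ x}.Infinite) : MixedIdentityFree H := by
  classical
  rintro ⟨W, hW, hφ⟩
  obtain ⟨a, L, hL, rfl⟩ := exists_reducedWord W
  have hval : ∀ h : H, a * wordVal (MonoidHom.id H) h L = 1 := by
    intro h
    have := hφ (Monoid.Coprod.lift (MonoidHom.id H) (zpowersHom H h)) (by ext; simp)
    rw [map_mul, map_wordVal] at this
    simpa using this
  cases L with
  | nil =>
    apply hW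
    have := hval 1
    simp only [wordVal, mul_one] at this
    simp [wordVal, this]
  | cons b L =>
    obtain ⟨ε, b⟩ := b
    obtain ⟨p⟩ : Nonempty Ω := inferInstance
    obtain ⟨P, r, hP, hr, hh⟩ := exists_partialInjection_of_reducedWord hinf p ε b L hL
    -- The last letter is sent to q with a • q ≠ p, so the word does not fix p.
    obtain ⟨q, hq⟩ := Infinite.exists_notMem_finset (insert (a⁻¹ • p) (touched P))
    simp only [Finset.mem_insert, not_or] at hq
    obtain ⟨h, hext⟩ := hH.exists_extends _ (isPartialInjection_insert hP ε hr hq.2)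
    have h1 := hh h fun a ha => hext a (Finset.mem_insert_of_mem ha)
    have h2 := letter_smul_of_extends h ε (hext _ (Finset.mem_insert_self _ _))
    have h3 := congrArg (· • p) (hval h)
    simp only [MonoidHom.id_apply, wordVal, one_smul] at h1 h3
    rw [mul_smul, mul_smul, h1, h2] at h3
    exact hq.1 (by rw [← h3, inv_smul_smul])

end MixedIdentities

/-! ### The self-similar permutation and its limit. -/

section Construction

variable {G : Type*} [Group G]

/-- The `ℤ`-coordinate. -/
def height (a : G × Multiplicative ℤ) : ℤ := a.2.toAdd

/-- The central element with `ℤ`-coordinate `n`. -/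
def shift (G : Type*) [Group G] (n : ℤ) : G × Multiplicative ℤ := (1, Multiplicative.ofAdd n)

@[simp] theorem height_mul (a b : G × Multiplicative ℤ) :
    height (a * b) = height a + height b := rfl

@[simp] theorem height_inv (a : G × Multiplicative ℤ) : height a⁻¹ = -height a := rfl

@[simp] theorem height_shift (n : ℤ) : height (shift G n) = n := rfl

theorem mul_shift_comm (n : ℤ) (a : G × Multiplicative ℤ) : a * shift G n = shift G n * a := by
  ext <;> simp [shift, mul_comm]

theorem leftRegular_apply {A : Type*} [Group A] (a x : A) : leftRegular A a x = a * x := rfl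

@[simp] theorem conj_leftRegular_apply {A : Type*} [Group A] (a x : A) (τ : Equiv.Perm A) :
    (leftRegular A a * τ * (leftRegular A a)⁻¹) x = a * τ (a⁻¹ * x) := by
  rw [← map_inv]
  rfl

variable (f : ℕ → G × Multiplicative ℤ)

/-- Bounds for the heights of the supports of the permutations `approx f k`. -/
def radius : ℕ → ℕ
  | 0 => 0
  -- The second copy sits at heights from 20 gaps to 20 gaps plus `radius f k`, which is below 21
  -- gaps.
  | k + 1 => 21 * (radius k + (height (f k)).natAbs + k + 1)

/-- The scale of the gaps introduced at step `k`. -/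
def gap (k : ℕ) : ℕ := radius f k + (height (f k)).natAbs + k + 1

omit [Group G] in
theorem radius_succ (k : ℕ) : radius f (k + 1) = 21 * gap f k := rfl

omit [Group G] in
theorem radius_add_lt_gap (k : ℕ) : radius f k + (height (f k)).natAbs + k < gap f k :=
  Nat.lt_succ_self _

omit [Group G] in
theorem gap_succ (k : ℕ) : 21 * gap f k ≤ gap f (k + 1) := by
  have := radius_add_lt_gap f (k + 1)
  rw [radius_succ] at this
  omega

omit [Group G] in
theorem gap_mono : Monotone (gap f) :=
  monotone_nat_of_le_succ fun k => by have := gap_succ f k; omega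

open Classical in
/-- The finitely supported permutations whose limit is `limitPerm f`. Each consists of two distant
copies of the preceding one and of one isolated transposition. -/
noncomputable def approx : ℕ → Equiv.Perm (G × Multiplicative ℤ)
  | 0 => 1
  | k + 1 => approx k *
      (leftRegular _ (shift G (20 * gap f k)) * approx k *
        (leftRegular _ (shift G (20 * gap f k)))⁻¹) *
      Equiv.swap (shift G (10 * gap f k)) (shift G (10 * gap f k) * f k)

open Classical in
theorem approx_succ_apply (k : ℕ) (y : G × Multiplicative ℤ) :
    approx f (k + 1) y = approx f k (shift G (20 * gap f k) * approx f k
      ((shift G (20 * gap f k))⁻¹ *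
        Equiv.swap (shift G (10 * gap f k)) (shift G (10 * gap f k) * f k) y)) := by
  rw [approx, Equiv.Perm.mul_apply, Equiv.Perm.mul_apply, conj_leftRegular_apply]

open Classical in
theorem isolatedSwap_apply_of_lt (k : ℕ) (y : G × Multiplicative ℤ)
    (h : height y < 9 * gap f k) :
    Equiv.swap (shift G (10 * gap f k)) (shift G (10 * gap f k) * f k) y = y := by
  have := radius_add_lt_gap f k
  refine Equiv.swap_apply_of_ne_of_ne ?_ ?_ <;> rintro rfl <;>
    simp only [height_mul, height_shift] at h <;> omega

open Classical in
theorem isolatedSwap_apply_of_gt (k : ℕ) (y : G × Multiplicative ℤ)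
    (h : 11 * gap f k < height y) :
    Equiv.swap (shift G (10 * gap f k)) (shift G (10 * gap f k) * f k) y = y := by
  have := radius_add_lt_gap f k
  refine Equiv.swap_apply_of_ne_of_ne ?_ ?_ <;> rintro rfl <;>
    simp only [height_mul, height_shift] at h <;> omega

open Classical in
theorem isolatedSwap_apply_cases (k : ℕ) (y : G × Multiplicative ℤ) :
    Equiv.swap (shift G (10 * gap f k)) (shift G (10 * gap f k) * f k) y = y ∨
    (9 * gap f k ≤ height y ∧ height y ≤ 11 * gap f k ∧
      9 * gap f k ≤ height
        (Equiv.swap (shift G (10 * gap f k)) (shift G (10 * gap f k) * f k) y) ∧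
      height (Equiv.swap (shift G (10 * gap f k)) (shift G (10 * gap f k) * f k) y)
        ≤ 11 * gap f k) := by
  have := radius_add_lt_gap f k
  rcases eq_or_ne y (shift G (10 * gap f k)) with rfl | h1
  · right
    rw [Equiv.swap_apply_left]
    simp only [height_mul, height_shift]
    omega
  rcases eq_or_ne y (shift G (10 * gap f k) * f k) with rfl | h2
  · right
    rw [Equiv.swap_apply_right]
    simp only [height_mul, height_shift]
    omega
  · exact Or.inl (Equiv.swap_apply_of_ne_of_ne h1 h2)

/-- The support of `approx f k` lies in the heights from `0` to `radius f k`. -/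
theorem approx_apply_eq_self_or (k : ℕ) (y : G × Multiplicative ℤ) :
    approx f k y = y ∨ (0 ≤ height y ∧ height y ≤ radius f k ∧
      0 ≤ height (approx f k y) ∧ height (approx f k y) ≤ radius f k) := by
  suffices h : ∀ y, approx f k y ≠ y → 0 ≤ height y ∧ height y ≤ radius f k by
    by_cases hy : approx f k y = y
    · exact Or.inl hy
    · have h1 := h y hy
      have h2 := h (approx f k y) fun h => hy ((approx f k).injective h)
      exact Or.inr ⟨h1.1, h1.2, h2.1, h2.2⟩
  classical
  induction k with
  | zero => exact fun y hy => absurd rfl hy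
  | succ k ih =>
    intro y hy
    by_contra hcon
    apply hy
    have hgap := radius_add_lt_gap f k
    have hfix : ∀ z, ¬ (0 ≤ height z ∧ height z ≤ radius f k) → approx f k z = z := fun z hz => by
      by_contra h
      exact hz (ih z h)
    rw [radius_succ] at hcon
    push_cast at hcon
    have hswap : Equiv.swap (shift G (10 * gap f k)) (shift G (10 * gap f k) * f k) y = y := by
      rcases lt_or_ge (height y) 0 with h | h
      · exact isolatedSwap_apply_of_lt f k y (by omega)
      · exact isolatedSwap_apply_of_gt f k y (by omega)
    rw [approx_succ_apply, hswap, hfix (_ * y), mul_inv_cancel_left, hfix]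
    · omega
    · simp only [height_mul, height_inv, height_shift]
      omega

theorem approx_apply_of_neg (k : ℕ) (y : G × Multiplicative ℤ) (h : height y < 0) :
    approx f k y = y := by
  rcases approx_apply_eq_self_or f k y with h1 | h1
  · exact h1
  · omega

theorem approx_apply_of_gt (k : ℕ) (y : G × Multiplicative ℤ) (h : radius f k < height y) :
    approx f k y = y := by
  rcases approx_apply_eq_self_or f k y with h1 | h1
  · exact h1
  · omega

/-- In units of `gap f k`, the three factors of `approx f (k + 1)` live in the heights [0, 1), (9,
11) and [20, 21). Away from the other two supports only one factor acts. -/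
theorem approx_succ_apply_of_lt (k : ℕ) (y : G × Multiplicative ℤ) (h : height y < 9 * gap f k) :
    approx f (k + 1) y = approx f k y := by
  rw [approx_succ_apply, isolatedSwap_apply_of_lt f k y h, approx_apply_of_neg f k (_⁻¹ * _),
    mul_inv_cancel_left]
  simp only [height_mul, height_inv, height_shift]
  omega

theorem approx_succ_apply_of_gt (k : ℕ) (y : G × Multiplicative ℤ) (h : 11 * gap f k < height y) :
    approx f (k + 1) y =
      shift G (20 * gap f k) * approx f k ((shift G (20 * gap f k))⁻¹ * y) := by
  have hgap := radius_add_lt_gap f k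
  rw [approx_succ_apply, isolatedSwap_apply_of_gt f k y h]
  apply approx_apply_of_gt
  rcases approx_apply_eq_self_or f k ((shift G (20 * gap f k))⁻¹ * y) with h1 | h1
  · rw [h1, mul_inv_cancel_left]
    omega
  · rw [height_mul, height_shift]
    omega

open Classical in
theorem approx_succ_apply_of_mid (k : ℕ) (y : G × Multiplicative ℤ) (h : radius f k < height y)
    (h' : height y < 20 * gap f k) :
    approx f (k + 1) y =
      Equiv.swap (shift G (10 * gap f k)) (shift G (10 * gap f k) * f k) y := by
  have hgap := radius_add_lt_gap f k
  rw [approx_succ_apply]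
  rcases isolatedSwap_apply_cases f k y with h1 | ⟨h1, h2, h3, h4⟩
  · rw [h1, approx_apply_of_neg f k (_⁻¹ * _), mul_inv_cancel_left, approx_apply_of_gt f k y h]
    simp only [height_mul, height_inv, height_shift]
    omega
  · rw [approx_apply_of_neg f k (_⁻¹ * _), mul_inv_cancel_left, approx_apply_of_gt f k]
    · omega
    · simp only [height_mul, height_inv, height_shift]
      omega

theorem approx_apply_eq_of_le {k l : ℕ} (hkl : k ≤ l) (y : G × Multiplicative ℤ)
    (h : height y < 9 * gap f k) : approx f l y = approx f k y := by
  induction l, hkl using Nat.le_induction with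
  | base => rfl
  | succ l hl ih =>
    have := gap_mono f hl
    rw [approx_succ_apply_of_lt f l y (by omega), ih]

theorem approx_apply_eq_approx_natAbs {k : ℕ} (y : G × Multiplicative ℤ)
    (h : height y < 9 * gap f k) : approx f (height y).natAbs y = approx f k y := by
  rcases le_total k (height y).natAbs with hk | hk
  · exact approx_apply_eq_of_le f hk y h
  · refine (approx_apply_eq_of_le f hk y ?_).symm
    have := radius_add_lt_gap f (height y).natAbs
    omega

theorem approx_symm_apply_eq_of_le {k l : ℕ} (hkl : k ≤ l) (y : G × Multiplicative ℤ)
    (h : height y < 9 * gap f k) : (approx f l).symm y = (approx f k).symm y := by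
  have hgap := radius_add_lt_gap f k
  obtain ⟨x, rfl⟩ := (approx f k).surjective y
  rw [Equiv.symm_apply_eq, Equiv.symm_apply_apply, approx_apply_eq_of_le f hkl]
  rcases approx_apply_eq_self_or f k x with h1 | h1
  · rwa [h1] at h
  · omega

theorem approx_symm_apply_eq_approx_natAbs {k : ℕ} (y : G × Multiplicative ℤ)
    (h : height y < 9 * gap f k) :
    (approx f (height y).natAbs).symm y = (approx f k).symm y := by
  rcases le_total k (height y).natAbs with hk | hk
  · exact approx_symm_apply_eq_of_le f hk y h
  · refine (approx_symm_apply_eq_of_le f hk y ?_).symm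
    have := radius_add_lt_gap f (height y).natAbs
    omega

/-- The limit of the permutations `approx f k`. -/
noncomputable def limitPerm : Equiv.Perm (G × Multiplicative ℤ) where
  -- Stage |height y| is already stable at y because n < `gap f n`.
  toFun y := approx f (height y).natAbs y
  invFun y := (approx f (height y).natAbs).symm y
  left_inv y := by
    beta_reduce
    -- A stage stable at both the point and its image, so that one permutation and its inverse are
    -- compared.
    set k := max (height y).natAbs (height (approx f (height y).natAbs y)).natAbs
    have hk := radius_add_lt_gap f k
    rw [approx_symm_apply_eq_approx_natAbs f (k := k) _ (by omega),
      approx_apply_eq_approx_natAbs f (k := k) y (by omega), Equiv.symm_apply_apply]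
  right_inv y := by
    beta_reduce
    set k := max (height y).natAbs (height ((approx f (height y).natAbs).symm y)).natAbs
    have hk := radius_add_lt_gap f k
    rw [approx_apply_eq_approx_natAbs f (k := k) _ (by omega),
      approx_symm_apply_eq_approx_natAbs f (k := k) y (by omega), Equiv.apply_symm_apply]

theorem limitPerm_apply {k : ℕ} (y : G × Multiplicative ℤ) (h : height y < 9 * gap f k) :
    limitPerm f y = approx f k y :=
  approx_apply_eq_approx_natAbs f y h

theorem limitPerm_apply_of_neg (y : G × Multiplicative ℤ) (h : height y < 0) :
    limitPerm f y = y := by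
  rw [limitPerm_apply f (k := 0) y (by omega), approx_apply_of_neg f 0 y h]

open Classical in
theorem limitPerm_apply_of_mid (k : ℕ) (y : G × Multiplicative ℤ) (h : radius f k < height y)
    (h' : height y < 20 * gap f k) :
    limitPerm f y =
      Equiv.swap (shift G (10 * gap f k)) (shift G (10 * gap f k) * f k) y := by
  have := gap_succ f k
  rw [limitPerm_apply f (k := k + 1) y (by omega), approx_succ_apply_of_mid f k y h h']

/-- The shifted point lies between 12 and 28 gaps, where only the second copy of `approx f k` acts
before the next stage interferes. This recurrence yields infinite supports. -/
theorem limitPerm_shift_mul (k : ℕ) (y : G × Multiplicative ℤ)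
    (h : (height y).natAbs < 8 * gap f k) :
    limitPerm f (shift G (20 * gap f k) * y) = shift G (20 * gap f k) * limitPerm f y := by
  have := gap_succ f k
  rw [limitPerm_apply f (k := k + 1) (_ * y), limitPerm_apply f (k := k) y (by omega),
    approx_succ_apply_of_gt, inv_mul_cancel_left]
  · simp only [height_mul, height_shift]
    omega
  · simp only [height_mul, height_shift]
    omega

end Construction

/-! ### Bounded invariant sets and local finiteness. -/

section BoundedInvariantSets

variable {G : Type*} [Group G] (f : ℕ → G × Multiplicative ℤ)

/-- `C` is mapped to itself by the conjugates of `τ` by the translations from `S`. -/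
def IsInvariantUnder (S : Finset (G × Multiplicative ℤ)) (τ : Equiv.Perm (G × Multiplicative ℤ))
    (C : Finset (G × Multiplicative ℤ)) : Prop :=
  ∀ s ∈ S, ∀ y ∈ C, s * τ (s⁻¹ * y) ∈ C

/-- Every point lies in a set of at most `n` points which is invariant under the conjugates of `τ`
by the translations from `S`. -/
def HasBoundedInvariantSets (n : ℕ) (S : Finset (G × Multiplicative ℤ))
    (τ : Equiv.Perm (G × Multiplicative ℤ)) : Prop :=
  ∀ x, ∃ C : Finset (G × Multiplicative ℤ), x ∈ C ∧ C.card ≤ n ∧ IsInvariantUnder S τ C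

variable {f} {S : Finset (G × Multiplicative ℤ)} {k n : ℕ}

theorem finite_setOf_approx_apply_ne (f : ℕ → G × Multiplicative ℤ) (k : ℕ) :
    {x | approx f k x ≠ x}.Finite := by
  classical
  induction k with
  | zero => simp [approx]
  | succ k ih =>
    refine ((ih.union (ih.image fun x => shift G (20 * gap f k) * x)).union
      (Set.toFinite {shift G (10 * gap f k), shift G (10 * gap f k) * f k})).subset fun x hx => ?_
    by_contra hcon
    simp only [Set.mem_union, Set.mem_image, Set.mem_ofPred_eq, Set.mem_insert_iff,
      Set.mem_singleton_iff, not_or, not_exists, not_and, not_not] at hcon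
    obtain ⟨⟨h1, h2⟩, h3, h4⟩ := hcon
    apply hx
    rw [approx_succ_apply, Equiv.swap_apply_of_ne_of_ne h3 h4]
    have h5 : approx f k ((shift G (20 * gap f k))⁻¹ * x) = (shift G (20 * gap f k))⁻¹ * x := by
      by_contra h
      exact h2 _ h (mul_inv_cancel_left _ _)
    rw [h5, mul_inv_cancel_left, h1]

/-- The S-translates of the finite support form one invariant set, and all other points are fixed.
-/
theorem exists_hasBoundedInvariantSets_approx (f : ℕ → G × Multiplicative ℤ)
    (S : Finset (G × Multiplicative ℤ)) (k : ℕ) :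
    ∃ n, HasBoundedInvariantSets n S (approx f k) := by
  classical
  let T : Finset (G × Multiplicative ℤ) :=
    (S ×ˢ (finite_setOf_approx_apply_ne f k).toFinset).image fun a => a.1 * a.2
  refine ⟨T.card + 1, fun x => ⟨insert x T, Finset.mem_insert_self x T,
    Finset.card_insert_le x T, fun s hs y hy => ?_⟩⟩
  by_cases h : approx f k (s⁻¹ * y) = s⁻¹ * y
  · rwa [h, mul_inv_cancel_left]
  · refine Finset.mem_insert_of_mem (Finset.mem_image.2 ⟨(s, approx f k (s⁻¹ * y)), ?_, rfl⟩)
    simp only [Finset.mem_product, Set.Finite.mem_toFinset, Set.mem_ofPred_eq]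
    exact ⟨hs, fun h' => h ((approx f k).injective h')⟩

/-- Below the height of the isolated transposition of step `k`, invariant sets for `approx f k`
can be cut off. -/
theorem exists_invariantSet_of_lt (hS : ∀ s ∈ S, (height s).natAbs ≤ k)
    (hn : HasBoundedInvariantSets n S (approx f k)) (τ : Equiv.Perm (G × Multiplicative ℤ))
    (hτ : ∀ y, height y < 9 * gap f k → τ y = approx f k y)
    (x : G × Multiplicative ℤ) (hx : height x < 5 * gap f k) :
    ∃ C : Finset (G × Multiplicative ℤ), x ∈ C ∧ C.card ≤ n ∧ IsInvariantUnder S τ C := by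
  classical
  obtain ⟨C, hxC, hcard, hC⟩ := hn x
  -- The conjugates of `approx f k` move only points of height below one gap, so cutting at 5 gaps
  -- preserves invariance.
  refine ⟨C.filter fun y => height y < 5 * gap f k, by simp [hxC, hx],
    (Finset.card_filter_le _ _).trans hcard, fun s hs y hy => ?_⟩
  obtain ⟨hyC, hy⟩ := Finset.mem_filter.1 hy
  have hsk := hS s hs
  have hgap := radius_add_lt_gap f k
  rw [hτ]
  · refine Finset.mem_filter.2 ⟨hC s hs y hyC, ?_⟩
    rcases approx_apply_eq_self_or f k (s⁻¹ * y) with h | h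
    · rwa [h, mul_inv_cancel_left]
    · rw [height_mul]
      omega
  · rw [height_mul, height_inv]
    omega

/-- The same n survives. Below 5 gaps and from 15 gaps on, sets for `approx f k` can be cut off and
reused; in between only the |S| conjugates of the transposition act, involving at most 2|S| points.
-/
theorem HasBoundedInvariantSets.approx_succ (hS : ∀ s ∈ S, (height s).natAbs ≤ k)
    (hn : HasBoundedInvariantSets n S (approx f k)) (hSn : S.card * 2 + 1 ≤ n) :
    HasBoundedInvariantSets n S (approx f (k + 1)) := by
  classical
  intro x
  have hgap := radius_add_lt_gap f k
  rcases lt_or_ge (height x) (5 * gap f k) with hx | hx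
  · exact exists_invariantSet_of_lt hS hn _ (approx_succ_apply_of_lt f k) x hx
  rcases lt_or_ge (height x) (15 * gap f k) with hx' | hx'
  · let D : Finset (G × Multiplicative ℤ) :=
      {shift G (10 * gap f k), shift G (10 * gap f k) * f k}
    let T : Finset (G × Multiplicative ℤ) := (S ×ˢ D).image fun a => a.1 * a.2
    have hT : T.card ≤ S.card * 2 := by
      refine Finset.card_image_le.trans ?_
      rw [Finset.card_product]
      exact Nat.mul_le_mul_left _ Finset.card_le_two
    have hTh : ∀ y ∈ T, 5 * gap f k ≤ height y ∧ height y < 15 * gap f k := by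
      intro y hy
      obtain ⟨⟨s, d⟩, hsd, rfl⟩ := Finset.mem_image.1 hy
      obtain ⟨hs, hd⟩ := Finset.mem_product.1 hsd
      have hsk := hS s hs
      simp only [D, Finset.mem_insert, Finset.mem_singleton] at hd
      rcases hd with rfl | rfl <;> simp only [height_mul, height_shift] <;> omega
    refine ⟨insert x T, Finset.mem_insert_self x T,
      (Finset.card_insert_le x T).trans (by omega), fun s hs y hy => ?_⟩
    have hyh : 5 * gap f k ≤ height y ∧ height y < 15 * gap f k := by
      rcases Finset.mem_insert.1 hy with rfl | hy
      · exact ⟨hx, hx'⟩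
      · exact hTh y hy
    have hsk := hS s hs
    rw [approx_succ_apply_of_mid]
    · by_cases h : s⁻¹ * y ∈ D
      · refine Finset.mem_insert_of_mem (Finset.mem_image.2
          ⟨(s, Equiv.swap (shift G (10 * gap f k)) (shift G (10 * gap f k) * f k) (s⁻¹ * y)),
            Finset.mem_product.2 ⟨hs, ?_⟩, rfl⟩)
        simp only [D, Finset.mem_insert, Finset.mem_singleton] at h ⊢
        rcases h with h | h <;> rw [h]
        · exact Or.inr (Equiv.swap_apply_left _ _)
        · exact Or.inl (Equiv.swap_apply_right _ _)
      · simp only [D, Finset.mem_insert, Finset.mem_singleton, not_or] at h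
        rwa [Equiv.swap_apply_of_ne_of_ne h.1 h.2, mul_inv_cancel_left]
    · rw [height_mul, height_inv]
      omega
    · rw [height_mul, height_inv]
      omega
  -- Since u is central, the upper copies under all s in S are a single shift of the lower picture.
  · set u := shift G (20 * gap f k) with hu
    obtain ⟨C, hxC, hcard, hC⟩ := hn (u⁻¹ * x)
    refine ⟨(C.filter fun y => -(5 * gap f k : ℤ) ≤ height y).image fun y => u * y,
      Finset.mem_image.2 ⟨u⁻¹ * x, Finset.mem_filter.2 ⟨hxC, ?_⟩, mul_inv_cancel_left _ _⟩,
      Finset.card_image_le.trans ((Finset.card_filter_le _ _).trans hcard),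
      fun s hs y hy => ?_⟩
    · simp only [hu, height_mul, height_inv, height_shift]
      omega
    · obtain ⟨c, hc, rfl⟩ := Finset.mem_image.1 hy
      obtain ⟨hcC, hch⟩ := Finset.mem_filter.1 hc
      have hsk := hS s hs
      have hcomm : s⁻¹ * (u * c) = u * (s⁻¹ * c) := by
        rw [← mul_assoc, mul_shift_comm, mul_assoc]
      rw [hcomm, approx_succ_apply_of_gt, ← hu, inv_mul_cancel_left]
      · refine Finset.mem_image.2 ⟨s * approx f k (s⁻¹ * c),
          Finset.mem_filter.2 ⟨hC s hs c hcC, ?_⟩, ?_⟩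
        · rcases approx_apply_eq_self_or f k (s⁻¹ * c) with h | h
          · rwa [h, mul_inv_cancel_left]
          · rw [height_mul]
            omega
        · rw [← mul_assoc, ← mul_shift_comm, mul_assoc]
      · simp only [hu, height_mul, height_inv, height_shift]
        omega

/-- Once k bounds the heights of S, the size bound no longer grows with the stage and so passes to
the limit. -/
theorem exists_hasBoundedInvariantSets_limitPerm (f : ℕ → G × Multiplicative ℤ)
    (S : Finset (G × Multiplicative ℤ)) :
    ∃ n, HasBoundedInvariantSets n S (limitPerm f) := by
  set R := S.sup fun s => (height s).natAbs
  have hS : ∀ s ∈ S, (height s).natAbs ≤ R := fun s hs =>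
    Finset.le_sup (f := fun s => (height s).natAbs) hs
  obtain ⟨m, hm⟩ := exists_hasBoundedInvariantSets_approx f S R
  set n := max m (S.card * 2 + 1)
  have hstep : ∀ k, R ≤ k → HasBoundedInvariantSets n S (approx f k) := by
    intro k hk
    induction k, hk using Nat.le_induction with
    | base =>
      intro x
      obtain ⟨C, h1, h2, h3⟩ := hm x
      exact ⟨C, h1, h2.trans (le_max_left _ _), h3⟩
    | succ k hk ih => exact ih.approx_succ (fun s hs => (hS s hs).trans hk) (le_max_right _ _)
  refine ⟨n, fun x => ?_⟩
  obtain ⟨k, hRk, hxk⟩ : ∃ k, R ≤ k ∧ (height x).natAbs ≤ k :=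
    ⟨_, le_max_left _ _, le_max_right _ _⟩
  have hgap := radius_add_lt_gap f k
  exact exists_invariantSet_of_lt (fun s hs => (hS s hs).trans hRk)
    (hstep k hRk) _ (fun y hy => limitPerm_apply f y hy) x (by omega)

/-- The subgroup generated by the conjugates of a permutation by translations. -/
def conjClosure {A : Type*} [Group A] (τ : Equiv.Perm A) (S : Set A) : Subgroup (Equiv.Perm A) :=
  Subgroup.closure ((fun a => leftRegular A a * τ * (leftRegular A a)⁻¹) '' S)

theorem conjClosure_mono {A : Type*} [Group A] (τ : Equiv.Perm A) {S T : Set A} (h : S ⊆ T) :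
    conjClosure τ S ≤ conjClosure τ T :=
  Subgroup.closure_mono (Set.image_mono h)

theorem exists_finset_mem_conjClosure {A : Type*} [Group A] (τ : Equiv.Perm A)
    {g : Equiv.Perm A} (hg : g ∈ conjClosure τ Set.univ) :
    ∃ S : Finset A, g ∈ conjClosure τ (S : Set A) := by
  classical
  induction hg using Subgroup.closure_induction with
  | mem x hx =>
    obtain ⟨a, -, rfl⟩ := hx
    exact ⟨{a}, Subgroup.subset_closure ⟨a, by simp, rfl⟩⟩
  | one => exact ⟨∅, one_mem _⟩
  | mul x y _ _ hx hy =>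
    obtain ⟨S, hS⟩ := hx
    obtain ⟨T, hT⟩ := hy
    exact ⟨S ∪ T, mul_mem (conjClosure_mono τ (by simp) hS) (conjClosure_mono τ (by simp) hT)⟩
  | inv x _ hx =>
    obtain ⟨S, hS⟩ := hx
    exact ⟨S, inv_mem hS⟩

theorem exists_finset_subset_conjClosure {A : Type*} [Group A] (τ : Equiv.Perm A)
    (F : Finset (Equiv.Perm A)) (hF : ∀ g ∈ F, g ∈ conjClosure τ Set.univ) :
    ∃ S : Finset A, ∀ g ∈ F, g ∈ conjClosure τ (S : Set A) := by
  classical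
  choose! S hS using fun g (hg : g ∈ F) => exists_finset_mem_conjClosure τ (hF g hg)
  refine ⟨F.biUnion S, fun g hg => conjClosure_mono τ ?_ (hS g hg)⟩
  exact_mod_cast Finset.subset_biUnion_of_mem S hg

open scoped Pointwise in
theorem apply_mem_of_mem_conjClosure {τ : Equiv.Perm (G × Multiplicative ℤ)}
    {C : Finset (G × Multiplicative ℤ)} (hC : IsInvariantUnder S τ C)
    {g : Equiv.Perm (G × Multiplicative ℤ)} (hg : g ∈ conjClosure τ (S : Set (G × Multiplicative ℤ)))
    {y : G × Multiplicative ℤ} (hy : y ∈ C) : g y ∈ C := by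
  have hle : conjClosure τ (S : Set (G × Multiplicative ℤ)) ≤
      MulAction.stabilizer (Equiv.Perm (G × Multiplicative ℤ)) (C : Set (G × Multiplicative ℤ)) := by
    refine (Subgroup.closure_le _).2 ?_
    rintro _ ⟨s, hs, rfl⟩
    -- As C is finite, being mapped into C means being mapped onto C, so inverses are covered.
    rw [SetLike.mem_coe, MulAction.mem_stabilizer_set_iff_smul_set_subset C.finite_toSet]
    rintro _ ⟨y, hy, rfl⟩
    simpa using hC s hs y hy
  have h := MulAction.mem_stabilizer_iff.1 (hle hg)
  have h2 : g • y ∈ (C : Set (G × Multiplicative ℤ)) := h ▸ Set.smul_mem_smul_set hy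
  exact h2

/-- The conjugates of `limitPerm f` by translations generate a locally finite group. -/
theorem finite_of_fg_of_le_conjClosure (f : ℕ → G × Multiplicative ℤ)
    {K : Subgroup (Equiv.Perm (G × Multiplicative ℤ))} (hK : K.FG)
    (hle : K ≤ conjClosure (limitPerm f) Set.univ) : Finite K := by
  obtain ⟨F, rfl⟩ := hK
  obtain ⟨S, hS⟩ := exists_finset_subset_conjClosure (limitPerm f) F
    fun g hg => hle (Subgroup.subset_closure hg)
  obtain ⟨n, hn⟩ := exists_hasBoundedInvariantSets_limitPerm f S
  refine finite_of_bounded_invariant_sets (Ω := G × Multiplicative ℤ) n fun x => ?_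
  obtain ⟨C, hxC, hcard, hC⟩ := hn x
  refine ⟨C, hxC, hcard, fun k y hy => ?_⟩
  exact apply_mem_of_mem_conjClosure hC ((Subgroup.closure_le _).2 hS k.2) hy

end BoundedInvariantSets

/-! ### The group H, its transitivity and its extension structure. -/

section MainGroup

variable {G : Type*} [Group G] (f : ℕ → G × Multiplicative ℤ)

/-- The group generated by the translations and `limitPerm f`. -/
noncomputable def mainGroup : Subgroup (Equiv.Perm (G × Multiplicative ℤ)) :=
  (leftRegular (G × Multiplicative ℤ)).range ⊔ Subgroup.zpowers (limitPerm f)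

theorem leftRegular_mem_mainGroup (a : G × Multiplicative ℤ) :
    leftRegular _ a ∈ mainGroup f :=
  (le_sup_left : _ ≤ mainGroup f) ⟨a, rfl⟩

theorem limitPerm_mem_mainGroup : limitPerm f ∈ mainGroup f :=
  (le_sup_right : _ ≤ mainGroup f) (Subgroup.mem_zpowers _)

variable {f} in
theorem mainGroup_le {K : Subgroup (Equiv.Perm (G × Multiplicative ℤ))}
    (h1 : ∀ a, leftRegular (G × Multiplicative ℤ) a ∈ K) (h2 : limitPerm f ∈ K) :
    mainGroup f ≤ K := by
  refine sup_le ?_ (Subgroup.zpowers_le.2 h2)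
  rintro _ ⟨a, rfl⟩
  exact h1 a

theorem mainGroup_fg [Group.FG G] : (mainGroup f).FG := by
  refine Subgroup.FG.sup ((Group.fg_iff_subgroup_fg _).1 inferInstance) ⟨{limitPerm f}, ?_⟩
  rw [Finset.coe_singleton, Subgroup.zpowers_eq_closure]

/-- The permutations commuting with almost all of the shifts by `20 * gap f k` at each point. -/
def recurrentSubgroup : Subgroup (Equiv.Perm (G × Multiplicative ℤ)) where
  carrier := {h | ∀ y, ∃ K, ∀ k ≥ K,
    h (shift G (20 * gap f k) * y) = shift G (20 * gap f k) * h y}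
  one_mem' := fun _ => ⟨0, fun _ _ => rfl⟩
  mul_mem' := by
    intro g h hg hh y
    obtain ⟨K, hK⟩ := hh y
    obtain ⟨L, hL⟩ := hg (h y)
    refine ⟨max K L, fun k hk => ?_⟩
    rw [Equiv.Perm.mul_apply, hK k ((le_max_left _ _).trans hk),
      hL k ((le_max_right _ _).trans hk), Equiv.Perm.mul_apply]
  inv_mem' := by
    intro g hg y
    obtain ⟨K, hK⟩ := hg (g⁻¹ y)
    refine ⟨K, fun k hk => ?_⟩
    rw [Equiv.Perm.inv_eq_iff_eq, hK k hk]
    exact congrArg _ (g.apply_symm_apply y).symm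

theorem mainGroup_le_recurrentSubgroup : mainGroup f ≤ recurrentSubgroup f := by
  refine mainGroup_le (fun a y => ⟨0, fun k _ => ?_⟩) fun y => ⟨(height y).natAbs, fun k hk => ?_⟩
  · rw [leftRegular_apply, leftRegular_apply, ← mul_assoc, mul_shift_comm, mul_assoc]
  · have := radius_add_lt_gap f k
    exact limitPerm_shift_mul f k y (by omega)

/-- If p is moved, so are its shifts by `20 * gap f k` for all large k, and these are distinct
because the gaps strictly increase. -/
theorem infinite_setOf_smul_ne (h : mainGroup f) (hh : h ≠ 1) :
    {x : G × Multiplicative ℤ | h • x ≠ x}.Infinite := by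
  obtain ⟨p, hp⟩ : ∃ p, h.1 p ≠ p := by
    by_contra! hcon
    exact hh (Subtype.ext (Equiv.ext hcon))
  obtain ⟨K, hK⟩ := mainGroup_le_recurrentSubgroup f h.2 p
  have hinj : Function.Injective fun k : ℕ => shift G (20 * gap f (K + k)) * p := by
    intro k l hkl
    have h1 : height (shift G (20 * gap f (K + k))) = height (shift G (20 * gap f (K + l))) :=
      congrArg height (mul_right_cancel hkl)
    rw [height_shift, height_shift] at h1
    have hmono : StrictMono (gap f) := strictMono_nat_of_lt_succ fun n => by
      have h2 := gap_succ f n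
      have h3 := radius_add_lt_gap f n
      omega
    have h2 : K + k = K + l := hmono.injective (by omega)
    omega
  refine (Set.infinite_range_of_injective hinj).mono ?_
  rintro _ ⟨k, rfl⟩
  change h.1 (shift G (20 * gap f (K + k)) * p) ≠ shift G (20 * gap f (K + k)) * p
  rw [hK (K + k) (Nat.le_add_right _ _)]
  exact fun h => hp (mul_left_cancel h)

-- Take k large with f k = p⁻¹q. Translation by p c⁻¹ carries the isolated transposition (c, c p⁻¹
-- q) to (p, q), and carries points of its quiet window onto p and all of Y.
variable {f} in
theorem movesRelFinite_mainGroup (hf : ∀ a, ∀ N, ∃ k ≥ N, f k = a) :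
    MovesRelFinite (mainGroup f) (G × Multiplicative ℤ) := by
  classical
  intro Y p q hp hq
  obtain ⟨k, hk, hfk⟩ := hf (p⁻¹ * q) (Y.sup fun y => (height (p⁻¹ * y)).natAbs)
  have hgap := radius_add_lt_gap f k
  set c := shift G (10 * gap f k) with hc
  have hval : ∀ y, (height (p⁻¹ * y)).natAbs ≤ k →
      (leftRegular _ (p * c⁻¹) * limitPerm f * (leftRegular _ (p * c⁻¹))⁻¹) y =
        p * c⁻¹ * Equiv.swap c (c * (p⁻¹ * q)) (c * (p⁻¹ * y)) := by
    intro y hy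
    have h1 : (p * c⁻¹)⁻¹ * y = c * (p⁻¹ * y) := by group
    rw [conj_leftRegular_apply, h1, limitPerm_apply_of_mid f k, ← hc, hfk]
    · rw [hc, height_mul, height_shift]
      omega
    · rw [hc, height_mul, height_shift]
      omega
  refine ⟨⟨_, mul_mem (mul_mem (leftRegular_mem_mainGroup f (p * c⁻¹)) (limitPerm_mem_mainGroup f))
    (inv_mem (leftRegular_mem_mainGroup f (p * c⁻¹)))⟩, fun y hy => ?_, ?_⟩
  · refine (hval y ?_).trans ?_
    · exact (Finset.le_sup (f := fun y => (height (p⁻¹ * y)).natAbs) hy).trans hk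
    · rw [Equiv.swap_apply_of_ne_of_ne]
      · group
      · intro h
        rw [mul_eq_left, inv_mul_eq_one] at h
        exact hp (h ▸ hy)
      · intro h
        exact hq (mul_left_cancel (mul_left_cancel h) ▸ hy)
  · refine (hval p (by simp [height])).trans ?_
    rw [inv_mul_cancel, mul_one, Equiv.swap_apply_left]
    group

/-- The permutations agreeing with some translation at all points of sufficiently small height. -/
def eventuallyTranslation (G : Type*) [Group G] :
    Subgroup (Equiv.Perm (G × Multiplicative ℤ)) where
  carrier := {h | ∃ a, ∃ N : ℤ, ∀ y, height y < N → h y = a * y}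
  one_mem' := ⟨1, 0, fun y _ => (one_mul y).symm⟩
  mul_mem' := by
    rintro g h ⟨a, M, ha⟩ ⟨b, N, hb⟩
    refine ⟨a * b, min N (M - height b), fun y hy => ?_⟩
    rw [Equiv.Perm.mul_apply, hb y (by omega), ha _ (by rw [height_mul]; omega), mul_assoc]
  inv_mem' := by
    rintro g ⟨a, M, ha⟩
    refine ⟨a⁻¹, M + height a, fun y hy => ?_⟩
    rw [Equiv.Perm.inv_eq_iff_eq, ha _ (by rw [height_mul, height_inv]; omega),
      mul_inv_cancel_left]

theorem mainGroup_le_eventuallyTranslation : mainGroup f ≤ eventuallyTranslation G :=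
  mainGroup_le (fun a => ⟨a, 0, fun _ _ => rfl⟩)
    ⟨1, 0, fun y hy => by rw [limitPerm_apply_of_neg f y hy, one_mul]⟩

theorem eq_of_eventually_eq {g : Equiv.Perm (G × Multiplicative ℤ)} {a b : G × Multiplicative ℤ}
    {M N : ℤ} (ha : ∀ y, height y < M → g y = a * y) (hb : ∀ y, height y < N → g y = b * y) :
    a = b := by
  have h1 := ha (shift G (min M N - 1)) (by rw [height_shift]; omega)
  have h2 := hb (shift G (min M N - 1)) (by rw [height_shift]; omega)
  exact mul_right_cancel (h1.symm.trans h2)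

/-- The translation with which an element of the group agrees at small heights. -/
noncomputable def translationPart : mainGroup f →* G × Multiplicative ℤ :=
  MonoidHom.mk' (fun h => (mainGroup_le_eventuallyTranslation f h.2).choose) (by
    intro g h
    obtain ⟨M, hM⟩ := (mainGroup_le_eventuallyTranslation f g.2).choose_spec
    obtain ⟨N, hN⟩ := (mainGroup_le_eventuallyTranslation f h.2).choose_spec
    obtain ⟨L, hL⟩ := (mainGroup_le_eventuallyTranslation f (g * h).2).choose_spec
    set a := (mainGroup_le_eventuallyTranslation f g.2).choose
    set b := (mainGroup_le_eventuallyTranslation f h.2).choose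
    refine eq_of_eventually_eq hL (N := min N (M - height b)) fun y hy => ?_
    rw [Subgroup.coe_mul, Equiv.Perm.mul_apply, hN y (by omega),
      hM _ (by rw [height_mul]; omega), mul_assoc])

variable {f} in
theorem translationPart_eq {h : mainGroup f} {a : G × Multiplicative ℤ} {N : ℤ}
    (ha : ∀ y, height y < N → h.1 y = a * y) : translationPart f h = a := by
  obtain ⟨M, hM⟩ := (mainGroup_le_eventuallyTranslation f h.2).choose_spec
  exact eq_of_eventually_eq hM ha

theorem translationPart_leftRegular (a : G × Multiplicative ℤ) :
    translationPart f ⟨_, leftRegular_mem_mainGroup f a⟩ = a :=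
  translationPart_eq (N := 0) fun _ _ => rfl

theorem conj_mem_conjClosure {A : Type*} [Group A] {τ g : Equiv.Perm A} (a : A)
    (hg : g ∈ conjClosure τ Set.univ) :
    leftRegular A a * g * (leftRegular A a)⁻¹ ∈ conjClosure τ Set.univ := by
  induction hg using Subgroup.closure_induction with
  | mem x hx =>
    obtain ⟨b, -, rfl⟩ := hx
    refine Subgroup.subset_closure ⟨a * b, Set.mem_univ _, ?_⟩
    simp only [map_mul]
    group
  | one => simp
  | mul x y _ _ hx hy =>
    convert mul_mem hx hy using 1
    group
  | inv x _ hx =>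
    convert inv_mem hx using 1
    group

/-- Translations normalise the group generated by the conjugates, so its product with the
translations is a subgroup containing all generators. -/
theorem exists_eq_mul_leftRegular (h : mainGroup f) :
    ∃ m ∈ conjClosure (limitPerm f) Set.univ, ∃ a, h.1 = m * leftRegular _ a := by
  let K : Subgroup (Equiv.Perm (G × Multiplicative ℤ)) :=
    { carrier := {h | ∃ m ∈ conjClosure (limitPerm f) Set.univ, ∃ a, h = m * leftRegular _ a}
      one_mem' := ⟨1, one_mem _, 1, by simp⟩
      mul_mem' := by
        rintro _ _ ⟨m, hm, a, rfl⟩ ⟨n, hn, b, rfl⟩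
        refine ⟨_, mul_mem hm (conj_mem_conjClosure a hn), a * b, ?_⟩
        rw [map_mul]
        group
      inv_mem' := by
        rintro _ ⟨m, hm, a, rfl⟩
        refine ⟨_, conj_mem_conjClosure a⁻¹ (inv_mem hm), a⁻¹, ?_⟩
        rw [map_inv]
        group }
  have hle : mainGroup f ≤ K := by
    refine mainGroup_le (fun a => ⟨1, one_mem _, a, by simp⟩) ⟨limitPerm f, ?_, 1, by simp⟩
    exact Subgroup.subset_closure ⟨1, Set.mem_univ _, by simp⟩
  exact hle h.2

theorem conjClosure_le_mainGroup : conjClosure (limitPerm f) Set.univ ≤ mainGroup f := by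
  refine (Subgroup.closure_le _).2 ?_
  rintro _ ⟨a, -, rfl⟩
  exact mul_mem (mul_mem (leftRegular_mem_mainGroup f a) (limitPerm_mem_mainGroup f))
    (inv_mem (leftRegular_mem_mainGroup f a))

theorem translationPart_of_mem_conjClosure {g : Equiv.Perm (G × Multiplicative ℤ)}
    (hg : g ∈ conjClosure (limitPerm f) Set.univ) :
    translationPart f ⟨g, conjClosure_le_mainGroup f hg⟩ = 1 := by
  have hle : conjClosure (limitPerm f) Set.univ ≤
      (translationPart f).ker.map (mainGroup f).subtype := by
    refine (Subgroup.closure_le _).2 ?_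
    rintro _ ⟨a, -, rfl⟩
    refine ⟨⟨_, conjClosure_le_mainGroup f (Subgroup.subset_closure ⟨a, Set.mem_univ _, rfl⟩)⟩,
      translationPart_eq (N := height a) fun y hy => ?_, rfl⟩
    rw [conj_leftRegular_apply, limitPerm_apply_of_neg, mul_inv_cancel_left, one_mul]
    rw [height_mul, height_inv]
    omega
  obtain ⟨h, hh, hhg⟩ := hle hg
  have : h = ⟨g, conjClosure_le_mainGroup f hg⟩ := Subtype.ext hhg
  rw [← this]
  exact hh

/-- In the factorisation h = m · a the translation part of h is a, so it is trivial only when h = m.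
-/
theorem map_ker_translationPart_le :
    (translationPart f).ker.map (mainGroup f).subtype ≤ conjClosure (limitPerm f) Set.univ := by
  rintro _ ⟨h, hh, rfl⟩
  obtain ⟨m, hm, a, hma⟩ := exists_eq_mul_leftRegular f h
  have h1 : h = ⟨m, conjClosure_le_mainGroup f hm⟩ * ⟨_, leftRegular_mem_mainGroup f a⟩ :=
    Subtype.ext hma
  have h2 : translationPart f h = a := by
    rw [h1, map_mul, translationPart_of_mem_conjClosure f hm, translationPart_leftRegular, one_mul]
  have h3 : a = 1 := h2.symm.trans hh
  rw [Subgroup.subtype_apply, hma, h3, map_one, mul_one]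
  exact hm

theorem locallyFiniteGroup_ker_translationPart :
    LocallyFiniteGroup (translationPart f).ker := by
  intro K hK
  let ι : (translationPart f).ker →* Equiv.Perm (G × Multiplicative ℤ) :=
    (mainGroup f).subtype.comp (translationPart f).ker.subtype
  have hι : Function.Injective ι := Subtype.coe_injective.comp Subtype.coe_injective
  have hfin : Finite (K.map ι) := by
    have : Group.FG K := (Group.fg_iff_subgroup_fg K).2 hK
    have hfg : (K.map ι).FG := (Group.fg_iff_subgroup_fg _).1
      (Group.fg_of_surjective (f := (K.equivMapOfInjective ι hι).toMonoidHom)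
        (K.equivMapOfInjective ι hι).surjective)
    refine finite_of_fg_of_le_conjClosure f hfg ?_
    rintro _ ⟨h, -, rfl⟩
    exact map_ker_translationPart_le f ⟨h.1, h.2, rfl⟩
  exact Finite.of_equiv _ (K.equivMapOfInjective ι hι).symm.toEquiv

end MainGroup

/-! ### Enumeration of A and the conclusion. -/

theorem countable_of_group_fg (G : Type*) [Group G] [Group.FG G] : Countable G := by
  obtain ⟨α, _, φ, hφ⟩ :=
    Group.fg_iff_exists_freeGroup_hom_surjective_finite.1 (inferInstance : Group.FG G)
  exact hφ.countable

/-- A nonempty countable type can be enumerated with infinite repetition. -/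
theorem exists_seq_frequently_eq (A : Type*) [Countable A] [Nonempty A] :
    ∃ f : ℕ → A, ∀ a, ∀ N, ∃ k ≥ N, f k = a := by
  obtain ⟨e, he⟩ := exists_surjective_nat A
  refine ⟨fun k => e k.unpair.1, fun a N => ?_⟩
  obtain ⟨i, rfl⟩ := he a
  exact ⟨Nat.pair i N, Nat.right_le_pair i N, by simp⟩

theorem theorem1 {G : Type*} [Group G] [Group.FG G] :
    ∃ H : Subgroup (Equiv.Perm (G × Multiplicative ℤ)),
      H.FG ∧
      (leftRegular (G × Multiplicative ℤ)).range ≤ H ∧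
      (∃ N : Subgroup H, LocallyFiniteGroup N ∧
        ∃ E : GroupExtension N H (G × Multiplicative ℤ), E.inl = N.subtype) ∧
      IsHighlyTransitive H (G × Multiplicative ℤ) ∧
      MixedIdentityFree H := by
  have hcount : Countable G := countable_of_group_fg G
  obtain ⟨f, hf⟩ := exists_seq_frequently_eq (G × Multiplicative ℤ)
  have hmoves := movesRelFinite_mainGroup hf
  refine ⟨mainGroup f, mainGroup_fg f, le_sup_left,
    ⟨(translationPart f).ker, locallyFiniteGroup_ker_translationPart f,
      { inl := (translationPart f).ker.subtype
        rightHom := translationPart f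
        inl_injective := Subtype.coe_injective
        range_inl_eq_ker_rightHom := Subgroup.range_subtype _
        rightHom_surjective := fun a => ⟨_, translationPart_leftRegular f a⟩ }, rfl⟩,
    hmoves.isHighlyTransitive, hmoves.mixedIdentityFree (infinite_setOf_smul_ne f)⟩
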